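/- Let $(\Omega,\mathcal F,\mathsf P)$ be a probability space, let $L^0$ be the space of real random variables on it modulo $\mathsf P$-a.s. equality, and let $\mathcal P$ be the set of probability measures on $\mathcal F$ that are absolutely continuous with respect to $\mathsf P$. For $\mathsf Q\in\mathcal P$ and $X\in L^0$ put $\mathsf E_{\mathsf Q}X=\mathsf E_{\mathsf Q}X^+-\mathsf E_{\mathsf Q}X^-\in[-\infty,\infty]$ with the convention $\infty-\infty=-\infty$. A coherent utility function is a map $u:L^0\to[-\infty,\infty]$ of the form $u(X)=\inf_{\mathsf Q\in\mathcal D}\mathsf E_{\mathsf Q}X$ with a nonempty set $\mathcal D\subseteq\mathcal P$; the largest such $\mathcal D$ is called the determining set of $u$. A subset of $\mathcal P$ is called weakly compact if the set of its densities with respect to $\mathsf P$ is compact in the weak topology of $L^1(\mathsf P)$. For $\mathcal D\subseteq\mathcal P$ put $$L^1_s(\mathcal D)=\Bigl\{X\in L^0:\lim_{k\to\infty}\sup_{\mathsf Q\in\mathcal D}\mathsf E_{\mathsf Q}|X|I(|X|>k)=0\Bigr\},$$ and for $A\subseteq L^0$ put $\mathcal R(A)=\{\mathsf Q\in\mathcal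 P:\mathsf E_{\mathsf Q}X\le0\text{ for all }X\in A\}$. The set $A$ is called $\mathcal D$-consistent if there is $A'\subseteq A\cap L^1_s(\mathcal D)$ with $\mathcal D\cap\mathcal R(A)=\mathcal D\cap\mathcal R(A')$. Let $u_1,\dots,u_N$ be coherent utility functions with weakly compact determining sets $\mathcal D_1,\dots,\mathcal D_N$. For each $n$ let $A_n\subseteq L^0$ be a $\mathcal D_n$-consistent convex cone containing $0$, and let $W_n\in L^1_s(\mathcal D_n)$. Let $S=(S^1,\dots,S^d)$ be a random vector whose components belong to $\bigcap_nL^1_s(\mathcal D_n)$. Define the maximal overall utility $$M=\sup\Bigl\{\sum_{n=1}^Nu_n(W_n+X_n+\langle h_n,S\rangle)\;:\;X_n\in A_n,\ h_n\in\mathbb R^d,\ \sum_{n=1}^Nh_n=0\Bigr\},$$ where the sum is understood as $-\infty$ if any of its summands equals $-\infty$. Put $$G_n=\mathop{\rm cl}\{\mathsf E_{\mathsf Q}S:\mathsf Q\in\mathcal D_n\cap\mathcal R(A_n)\},\qquad \widetilde G_n=\mathop{\rm cl}\{\mathsf E_{\mathsf Q}(S,W_n):\mathsf Q\in\mathcal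 D_n\cap\mathcal R(A_n)\},$$ $$f_n(x)=\inf\{y\in\mathbb R:(x,y)\in\widetilde G_n\}\ (x\in G_n),\qquad G=\bigcap_{n=1}^NG_n,\qquad f(x)=\sum_{n=1}^Nf_n(x)\ (x\in G).$$ Then $$M=\inf_{x\in G}f(x),$$ where $\inf\emptyset:=\infty$. -/

import Mathlib

open MeasureTheory Filter Topology
open scoped ENNReal

namespace CoherentRisk

noncomputable section

variable {Ω : Type*} [MeasurableSpace Ω]

/-- The probability measures on `Ω` that are absolutely continuous with respect to `P`. -/
def acProb (P : Measure Ω) : Set (Measure Ω) :=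
  {Q | IsProbabilityMeasure Q ∧ Q ≪ P}

/-- The expectation `E_Q X = E_Q X⁺ - E_Q X⁻` in `[-∞, ∞]`, with the convention `∞ - ∞ = -∞`
(which is the convention of `EReal`). -/
def expect {P : Measure Ω} (Q : Measure Ω) (X : Ω →ₘ[P] ℝ) : EReal :=
  ((∫⁻ ω, ENNReal.ofReal (X ω) ∂Q : ℝ≥0∞) : EReal)
    - ((∫⁻ ω, ENNReal.ofReal (-X ω) ∂Q : ℝ≥0∞) : EReal)

/-- `u(X) = inf_{Q ∈ D} E_Q X` for all `X ∈ L⁰`, where `D` is a nonempty set of probability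
measures absolutely continuous with respect to `P`. A coherent utility function on `L⁰` is a map
that admits such a `D`. -/
def Represents (P : Measure Ω) (u : (Ω →ₘ[P] ℝ) → EReal) (D : Set (Measure Ω)) : Prop :=
  D.Nonempty ∧ D ⊆ acProb P ∧ ∀ X : Ω →ₘ[P] ℝ, u X = ⨅ Q ∈ D, expect Q X

/-- `u` is a coherent utility function on `L⁰` and `D` is its determining set, that is, the
largest set representing `u`. -/
def IsDeterminingSet (P : Measure Ω) (u : (Ω →ₘ[P] ℝ) → EReal) (D : Set (Measure Ω)) : Prop :=
  IsGreatest {D' | Represents P u D'} D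

/-- The densities `dQ/dP ∈ L¹(P)` of the measures `Q ∈ D`. -/
def densities (P : Measure Ω) (D : Set (Measure Ω)) : Set (Lp ℝ 1 P) :=
  {g | ∃ Q ∈ D, g =ᵐ[P] fun ω => (Q.rnDeriv P ω).toReal}

/-- `D`, identified with a set of densities, is compact in the weak topology of `L¹(P)`. -/
def IsWeaklyCompact (P : Measure Ω) (D : Set (Measure Ω)) : Prop :=
  IsCompact (toWeakSpace ℝ (Lp ℝ 1 P) '' densities P D)

/-- The strong space `L¹_s(D)`: `sup_{Q ∈ D} E_Q (|X| 1_{|X| > k}) → 0` as `k → ∞`. -/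
def strongL1 (P : Measure Ω) (D : Set (Measure Ω)) : Set (Ω →ₘ[P] ℝ) :=
  {X | Tendsto (fun k : ℕ => ⨆ Q ∈ D, ∫⁻ ω in {ω | (k : ℝ) < |X ω|}, ENNReal.ofReal |X ω| ∂Q)
    atTop (𝓝 0)}

/-- The set `R(A)` of risk-neutral measures. -/
def riskNeutral {P : Measure Ω} (A : Set (Ω →ₘ[P] ℝ)) : Set (Measure Ω) :=
  {Q | Q ∈ acProb P ∧ ∀ X ∈ A, expect Q X ≤ 0}

/-- `A` is `D`-consistent. -/
def IsConsistent {P : Measure Ω} (D : Set (Measure Ω)) (A : Set (Ω →ₘ[P] ℝ)) : Prop :=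
  ∃ A' : Set (Ω →ₘ[P] ℝ), A' ⊆ A ∩ strongL1 P D ∧ D ∩ riskNeutral A = D ∩ riskNeutral A'

/-- The maximal overall utility `sup ∑ₙ uₙ(Wₙ + Xₙ + ⟨hₙ, S⟩)` over all `Xₙ ∈ Aₙ` and
`hₙ ∈ ℝᵈ` with `∑ₙ hₙ = 0`. In `EReal` a sum with a summand `-∞` is `-∞`. -/
def maxOverallUtility {P : Measure Ω} {N d : ℕ} (u : Fin N → (Ω →ₘ[P] ℝ) → EReal)
    (A : Fin N → Set (Ω →ₘ[P] ℝ)) (W : Fin N → (Ω →ₘ[P] ℝ)) (S : Fin d → (Ω →ₘ[P] ℝ)) : EReal :=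
  ⨆ (X : Fin N → (Ω →ₘ[P] ℝ)) (_ : ∀ n, X n ∈ A n)
    (h : Fin N → Fin d → ℝ) (_ : ∑ n, h n = 0),
    ∑ n, u n (W n + X n + ∑ i, h n i • S i)

/-- `cl {E_Q S : Q ∈ 𝒬} ⊆ ℝᵈ`. -/
def generator {P : Measure Ω} {d : ℕ} (𝒬 : Set (Measure Ω)) (S : Fin d → (Ω →ₘ[P] ℝ)) :
    Set (Fin d → ℝ) :=
  closure ((fun Q : Measure Ω => fun i => ∫ ω, S i ω ∂Q) '' 𝒬)

/-- `cl {E_Q (S, W) : Q ∈ 𝒬} ⊆ ℝᵈ × ℝ`. -/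
def jointGenerator {P : Measure Ω} {d : ℕ} (𝒬 : Set (Measure Ω)) (S : Fin d → (Ω →ₘ[P] ℝ))
    (W : Ω →ₘ[P] ℝ) : Set ((Fin d → ℝ) × ℝ) :=
  closure ((fun Q : Measure Ω => ((fun i => ∫ ω, S i ω ∂Q), ∫ ω, W ω ∂Q)) '' 𝒬)

/-- The lower boundary `x ↦ inf {y : (x, y) ∈ K}` of a set `K ⊆ ℝᵈ × ℝ`. -/
def lowerBoundary {d : ℕ} (K : Set ((Fin d → ℝ) × ℝ)) (x : Fin d → ℝ) : EReal :=
  ⨅ (y : ℝ) (_ : (x, y) ∈ K), (y : EReal)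

end

end CoherentRisk

/-! Upper bound: any common price vector `x` is a dual certificate. For a risk-neutral `Q` in `D n`,
the `X n` term contributes at most zero. Passing to the closure bounds the n-th utility by
`lowerBoundary` at `x` plus `⟨h n, x⟩`, and these price terms cancel because the trades sum to zero.

Lower bound: the payoff `∑ E_{Q n} (W n + X n + ⟨h n, S⟩)` is affine in the trade and in the tuple
`Q`, and weakly continuous in `Q` on the compact product of the `D n`, provided the `X n` are
regular. By minimax (`exists_forall_lt_of_forall_exists_lt`) it suffices to beat a level `r` for
each fixed tuple (`exists_trade_lt`). If some `Q m` is not risk-neutral, consistency supplies a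
claim that can be scaled up without bound. If two agents price `S` differently, trading between them
gains without bound. Otherwise the prices agree at some `x` in `G`, and already without trading the
payoff is at least `f x`. Convexity of `D n`, needed for minimax, comes from its maximality. -/

namespace CoherentRisk

/-! ### Minimax by finite-dimensional separation -/

/-- A one-sided minimax theorem: a strict lower bound that holds pointwise on a compact set, with a
parameter depending on the point, holds uniformly for a single parameter. -/
theorem exists_forall_lt_of_forall_exists_lt {E T : Type*} [AddCommGroup E] [Module ℝ E]
    [TopologicalSpace T] {C : Set E} {K : Set T} (hC : Convex ℝ C) (hK : IsCompact K)
    (hKne : K.Nonempty) (F : E → T → ℝ) (c : ℝ)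
    (hcont : ∀ e ∈ C, ContinuousOn (F e) K)
    (hconc : ∀ x ∈ K, ConcaveOn ℝ C fun e => F e x)
    (hconv : ∀ x ∈ K, ∀ y ∈ K, ∀ a b : ℝ, 0 ≤ a → 0 ≤ b → a + b = 1 →
      ∃ z ∈ K, ∀ e ∈ C, F e z = a * F e x + b * F e y)
    (hlt : ∀ x ∈ K, ∃ e ∈ C, c < F e x) :
    ∃ e ∈ C, ∀ x ∈ K, c < F e x := by
  classical
  choose! e heC hec using hlt
  -- Each `e x` still beats `c` near `x`, so finitely many of them suffice and the problem becomes
  -- one in `ℝ^t`.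
  obtain ⟨t, htK, ht⟩ := hK.elim_nhdsWithin_subcover (fun x => {y | c < F (e x) y}) fun x hx =>
    (hcont _ (heC x hx) x hx).eventually (lt_mem_nhds (hec x hx))
  let φ : T → t → ℝ := fun x j => F (e j) x
  have heC' : ∀ j : t, e j ∈ C := fun j => heC j (htK j j.2)
  have hφ : ContinuousOn φ K := continuousOn_pi.2 fun j => hcont _ (heC' j)
  have hconvφ : Convex ℝ (φ '' K) := by
    rintro _ ⟨x, hx, rfl⟩ _ ⟨y, hy, rfl⟩ a b ha hb hab
    obtain ⟨z, hz, hzF⟩ := hconv x hx y hy a b ha hb hab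
    exact ⟨z, hz, funext fun j => by simpa [φ] using hzF _ (heC' j)⟩
  have hdisj : Disjoint (φ '' K) (Set.Iic fun _ => c) := by
    refine Set.disjoint_left.2 ?_
    rintro _ ⟨x, hx, rfl⟩ hle
    obtain ⟨j, hj, hxj⟩ := Set.mem_iUnion₂.1 (ht hx)
    exact absurd (hle ⟨j, hj⟩) (not_le.2 hxj)
  obtain ⟨f, p, q, hp, hpq, hq⟩ := geometric_hahn_banach_compact_closed hconvφ
    (hK.image_of_continuousOn hφ) (convex_Iic (𝕜 := ℝ) fun _ : t => c) isClosed_Iic hdisj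
  -- The sign is flipped because the separating `f` is smaller on the image of `K` than on the
  -- orthant below `c`.
  let l : t → ℝ := fun j => -f (Pi.single j 1)
  have hf : ∀ v, f v = -∑ j, l j * v j := fun v => by
    conv_lhs => rw [← Finset.univ_sum_single v, map_sum]
    rw [← Finset.sum_neg_distrib]
    refine Finset.sum_congr rfl fun j _ => ?_
    have : Pi.single j (v j) = v j • (Pi.single j 1 : t → ℝ) := by
      rw [← Pi.single_smul, smul_eq_mul, mul_one]
    rw [this, map_smul, smul_eq_mul]
    simp only [l]
    ring
  have hl : ∀ j, 0 ≤ l j := fun j => by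
    by_contra! hneg
    set B := q - f fun _ => c
    -- Lowering coordinate `j` of the constant `c` by `s` stays in the orthant, where `f` exceeds
    -- `q`; a negative `l j` would violate this for large `s`.
    have key : ∀ s : ℝ, 0 ≤ s → B < s * l j := fun s hs => by
      have := hq ((fun _ => c) - s • Pi.single j 1) (by
        intro i
        by_cases hi : i = j
        · subst hi; simpa using hs
        · simp [Pi.single_eq_of_ne hi])
      rw [map_sub, map_smul, smul_eq_mul] at this
      simp only [l, B]
      linarith
    have h1 := key (|B| / -l j) (div_nonneg (abs_nonneg _) (by linarith))
    have h2 : |B| / -l j * l j = -|B| := by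
      have : l j ≠ 0 := hneg.ne
      field_simp
    linarith [neg_abs_le B]
  have hmain : ∀ x ∈ K, c * ∑ j, l j < ∑ j, l j * φ x j := fun x hx => by
    have h1 := hp _ ⟨x, hx, rfl⟩
    have h2 := hq (fun _ => c) (by simp)
    rw [hf] at h1 h2
    rw [← Finset.sum_mul] at h2
    linarith
  have hs : 0 < ∑ j, l j := by
    refine lt_of_le_of_ne (Finset.sum_nonneg fun j _ => hl j) fun h0 => ?_
    obtain ⟨x, hx⟩ := hKne
    have hz := (Finset.sum_eq_zero_iff_of_nonneg fun j _ => hl j).1 h0.symm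
    have h1 := hmain x hx
    rw [← h0, Finset.sum_eq_zero fun j hj => by rw [hz j hj, zero_mul]] at h1
    simp at h1
  set s := ∑ j, l j
  have hw1 : ∑ j, l j / s = 1 := by rw [← Finset.sum_div, div_self hs.ne']
  have hw0 : ∀ j ∈ Finset.univ, 0 ≤ l j / s := fun j _ => div_nonneg (hl j) hs.le
  refine ⟨∑ j, (l j / s) • e j, hC.sum_mem hw0 hw1 fun j _ => heC' j, fun x hx => ?_⟩
  refine lt_of_lt_of_le ?_ ((hconc x hx).le_map_sum hw0 hw1 fun j _ => heC' j)
  have : ∑ j, (l j / s) • F (e j) x = (∑ j, l j * φ x j) / s := by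
    rw [Finset.sum_div]
    exact Finset.sum_congr rfl fun j _ => by simp only [smul_eq_mul, φ]; ring
  rw [this, lt_div_iff₀ hs]
  exact hmain x hx

/-! ### Extended expectations and convexity of determining sets -/

variable {Ω : Type*} [MeasurableSpace Ω] {P : Measure Ω}

theorem expect_eq_integral {Q : Measure Ω} {X : Ω →ₘ[P] ℝ} (hX : Integrable X Q) :
    expect Q X = ((∫ ω, X ω ∂Q : ℝ) : EReal) := by
  have h1 : ∫⁻ ω, ENNReal.ofReal (X ω) ∂Q ≠ ∞ := hX.lintegral_lt_top.ne
  have h2 : ∫⁻ ω, ENNReal.ofReal (-X ω) ∂Q ≠ ∞ := hX.neg.lintegral_lt_top.ne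
  rw [integral_eq_lintegral_pos_part_sub_lintegral_neg_part hX, expect, EReal.coe_sub,
    EReal.coe_ennreal_toReal h1, EReal.coe_ennreal_toReal h2]

theorem integrable_of_lintegral_ofReal_ne_top {Q : Measure Ω} (hQ : Q ≪ P) {X : Ω →ₘ[P] ℝ}
    (h1 : ∫⁻ ω, ENNReal.ofReal (X ω) ∂Q ≠ ∞) (h2 : ∫⁻ ω, ENNReal.ofReal (-X ω) ∂Q ≠ ∞) :
    Integrable X Q := by
  refine ⟨X.aestronglyMeasurable.mono_ac hQ, ?_⟩
  rw [hasFiniteIntegral_iff_norm]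
  have : ∀ ω, ENNReal.ofReal ‖X ω‖ = ENNReal.ofReal (X ω) + ENNReal.ofReal (-X ω) := fun ω => by
    rcases le_total 0 (X ω) with h | h
    · rw [Real.norm_of_nonneg h, ENNReal.ofReal_of_nonpos (neg_nonpos.2 h), add_zero]
    · rw [Real.norm_of_nonpos h, ENNReal.ofReal_of_nonpos h, zero_add]
  simp_rw [this]
  rw [lintegral_add_left X.stronglyMeasurable.measurable.ennreal_ofReal]
  exact ENNReal.add_lt_top.2 ⟨h1.lt_top, h2.lt_top⟩

theorem expect_eq_bot {Q : Measure Ω} {X : Ω →ₘ[P] ℝ}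
    (h : ∫⁻ ω, ENNReal.ofReal (-X ω) ∂Q = ∞) : expect Q X = ⊥ := by
  simp [expect, h, sub_eq_add_neg]

/-- Claims in the cone need not be integrable. The convention `∞ - ∞ = -∞` saves the bound: an
infinite negative part of `X` survives adding the integrable `Y`, and otherwise the hypothesis
forces `X` to be integrable. -/
theorem expect_add_le {Q : Measure Ω} (hQ : Q ≪ P) {X Y : Ω →ₘ[P] ℝ} (hY : Integrable Y Q)
    (hX : expect Q X ≤ 0) : expect Q (Y + X) ≤ ((∫ ω, Y ω ∂Q : ℝ) : EReal) := by
  have hadd : ⇑(Y + X) =ᵐ[Q] fun ω => Y ω + X ω := hQ.ae_eq (AEEqFun.coeFn_add Y X)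
  by_cases h : ∫⁻ ω, ENNReal.ofReal (-X ω) ∂Q = ∞
  · refine (expect_eq_bot ?_).le.trans bot_le
    have hle : ∫⁻ ω, ENNReal.ofReal (-X ω) ∂Q ≤
        ∫⁻ ω, ENNReal.ofReal (-(Y + X) ω) ∂Q + ∫⁻ ω, ENNReal.ofReal (Y ω) ∂Q := by
      rw [← lintegral_add_right _ Y.stronglyMeasurable.measurable.ennreal_ofReal]
      refine lintegral_mono_ae (hadd.mono fun ω hω => ?_)
      refine le_trans (ENNReal.ofReal_le_ofReal ?_) ENNReal.ofReal_add_le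
      rw [hω]
      linarith
    rw [h, top_le_iff, ENNReal.add_eq_top] at hle
    exact hle.resolve_right hY.lintegral_lt_top.ne
  · have h1 : ∫⁻ ω, ENNReal.ofReal (X ω) ∂Q ≠ ∞ := fun h1 => by
      rw [expect, h1, EReal.coe_ennreal_top, ← EReal.coe_ennreal_toReal h, EReal.top_sub_coe] at hX
      exact absurd hX (by simp)
    have hXi := integrable_of_lintegral_ofReal_ne_top hQ h1 h
    rw [expect_eq_integral hXi] at hX
    have hYX : Integrable (Y + X : Ω →ₘ[P] ℝ) Q := (hY.add hXi).congr hadd.symm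
    rw [expect_eq_integral hYX, integral_congr_ae hadd, integral_add hY hXi]
    have : ∫ ω, X ω ∂Q ≤ 0 := by exact_mod_cast hX
    exact_mod_cast (by linarith)

/-- The mixture of two measures. -/
noncomputable def mix (a b : ℝ) (Q Q' : Measure Ω) : Measure Ω :=
  ENNReal.ofReal a • Q + ENNReal.ofReal b • Q'

theorem mix_mem_acProb {a b : ℝ} (ha : 0 ≤ a) (hb : 0 ≤ b) (hab : a + b = 1) {Q Q' : Measure Ω}
    (hQ : Q ∈ acProb P) (hQ' : Q' ∈ acProb P) : mix a b Q Q' ∈ acProb P := by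
  have := hQ.1
  have := hQ'.1
  refine ⟨⟨?_⟩, ?_⟩
  · simp only [mix, Measure.add_apply, Measure.smul_apply, smul_eq_mul, measure_univ, mul_one]
    rw [← ENNReal.ofReal_add ha hb, hab, ENNReal.ofReal_one]
  · exact Measure.AbsolutelyContinuous.add_left (hQ.2.smul_left _) (hQ'.2.smul_left _)

theorem integral_mix {a b : ℝ} (ha : 0 ≤ a) (hb : 0 ≤ b) {Q Q' : Measure Ω} {X : Ω → ℝ}
    (h : Integrable X Q) (h' : Integrable X Q') :
    ∫ ω, X ω ∂(mix a b Q Q') = a * ∫ ω, X ω ∂Q + b * ∫ ω, X ω ∂Q' := by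
  rw [mix, integral_add_measure (h.smul_measure ENNReal.ofReal_ne_top)
    (h'.smul_measure ENNReal.ofReal_ne_top), integral_smul_measure, integral_smul_measure,
    ENNReal.toReal_ofReal ha, ENNReal.toReal_ofReal hb, smul_eq_mul, smul_eq_mul]

theorem le_expect_mix {a b : ℝ} (ha : 0 ≤ a) (hb : 0 ≤ b) (hab : a + b = 1) {Q Q' : Measure Ω}
    (hQ : Q ≪ P) (hQ' : Q' ≪ P) {X : Ω →ₘ[P] ℝ} {m : EReal}
    (h : m ≤ expect Q X) (h' : m ≤ expect Q' X) : m ≤ expect (mix a b Q Q') X := by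
  rcases eq_or_ne m ⊥ with rfl | hm
  · exact bot_le
  have n1 : ∫⁻ ω, ENNReal.ofReal (-X ω) ∂Q ≠ ∞ := fun h0 =>
    hm (le_bot_iff.1 (h.trans (expect_eq_bot h0).le))
  have n2 : ∫⁻ ω, ENNReal.ofReal (-X ω) ∂Q' ≠ ∞ := fun h0 =>
    hm (le_bot_iff.1 (h'.trans (expect_eq_bot h0).le))
  by_cases hi : Integrable X (mix a b Q Q')
  -- A zero weight is treated separately, since integrability under the mixture then says nothing
  -- about the measure it multiplies.
  · rcases ha.eq_or_lt with rfl | ha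
    · obtain rfl : b = 1 := by linarith
      simpa [mix] using h'
    rcases hb.eq_or_lt with rfl | hb
    · obtain rfl : a = 1 := by linarith
      simpa [mix] using h
    have i1 : Integrable X Q := (integrable_smul_measure (by simpa using ha)
      ENNReal.ofReal_ne_top).1 (hi.mono_measure (Measure.le_add_right le_rfl))
    have i2 : Integrable X Q' := (integrable_smul_measure (by simpa using hb)
      ENNReal.ofReal_ne_top).1 (hi.mono_measure (Measure.le_add_left le_rfl))
    rw [expect_eq_integral i1] at h
    rw [expect_eq_integral i2] at h'
    rw [expect_eq_integral hi, integral_mix ha.le hb.le i1 i2]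
    set p := ∫ ω, X ω ∂Q
    set q := ∫ ω, X ω ∂Q'
    rcases le_total p q with hpq | hpq
    · refine h.trans (EReal.coe_le_coe_iff.2 ?_)
      have : a * p + b * p = p := by rw [← add_mul, hab, one_mul]
      nlinarith
    · refine h'.trans (EReal.coe_le_coe_iff.2 ?_)
      have : a * q + b * q = q := by rw [← add_mul, hab, one_mul]
      nlinarith
  · have hneg : ∫⁻ ω, ENNReal.ofReal (-X ω) ∂(mix a b Q Q') ≠ ∞ := by
      rw [mix, lintegral_add_measure, lintegral_smul_measure, lintegral_smul_measure]
      exact ENNReal.add_ne_top.2 ⟨ENNReal.mul_ne_top ENNReal.ofReal_ne_top n1,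
        ENNReal.mul_ne_top ENNReal.ofReal_ne_top n2⟩
    have hac : mix a b Q Q' ≪ P :=
      Measure.AbsolutelyContinuous.add_left (hQ.smul_left _) (hQ'.smul_left _)
    have hpos : ∫⁻ ω, ENNReal.ofReal (X ω) ∂(mix a b Q Q') = ∞ := by
      by_contra hpos
      exact hi (integrable_of_lintegral_ofReal_ne_top hac hpos hneg)
    rw [expect, hpos, EReal.coe_ennreal_top, ← EReal.coe_ennreal_toReal hneg, EReal.top_sub_coe]
    exact le_top

/-- Adjoining a mixture leaves every infimum unchanged, so the largest representing set already
contains it. -/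
theorem IsDeterminingSet.mix_mem {u : (Ω →ₘ[P] ℝ) → EReal} {D : Set (Measure Ω)}
    (hD : IsDeterminingSet P u D) {a b : ℝ} (ha : 0 ≤ a) (hb : 0 ≤ b) (hab : a + b = 1)
    {Q Q' : Measure Ω} (hQ : Q ∈ D) (hQ' : Q' ∈ D) : mix a b Q Q' ∈ D := by
  obtain ⟨⟨hne, hac, hu⟩, hmax⟩ := hD
  refine hmax (a := insert (mix a b Q Q') D) ⟨Set.insert_nonempty _ _, Set.insert_subset
    (mix_mem_acProb ha hb hab (hac hQ) (hac hQ')) hac, fun X => ?_⟩ (Set.mem_insert _ _)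
  rw [iInf_insert, hu X]
  exact (inf_eq_right.2 (le_expect_mix ha hb hab (hac hQ).2 (hac hQ').2 (iInf₂_le Q hQ)
    (iInf₂_le Q' hQ'))).symm

end CoherentRisk

/-! ### Weak continuity of expectations -/

namespace CoherentRisk

variable {Ω : Type*} [MeasurableSpace Ω] {P : Measure Ω}

/-- The random variables that are integrable under every `Q ∈ D` and whose expectation is weakly
continuous on the densities of `D`. -/
structure IsRegular (P : Measure Ω) (D : Set (Measure Ω)) (X : Ω →ₘ[P] ℝ) : Prop where
  integrable : ∀ Q ∈ D, Integrable X Q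
  continuousOn : ContinuousOn
    (fun w : WeakSpace ℝ (Lp ℝ 1 P) => ∫ ω, (toWeakSpace ℝ (Lp ℝ 1 P)).symm w ω * X ω ∂P)
    (toWeakSpace ℝ (Lp ℝ 1 P) '' densities P D)

theorem integral_density_mul [IsProbabilityMeasure P] {Q : Measure Ω} (hQ : Q ∈ acProb P) {g : Ω → ℝ}
    (hg : g =ᵐ[P] fun ω => (Q.rnDeriv P ω).toReal) (f : Ω → ℝ) :
    ∫ ω, g ω * f ω ∂P = ∫ ω, f ω ∂Q := by
  have := hQ.1
  rw [← integral_rnDeriv_smul hQ.2]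
  exact integral_congr_ae (hg.mono fun ω hω => by simp [hω])

theorem exists_mem_densities {D : Set (Measure Ω)} (hD : D ⊆ acProb P) {Q : Measure Ω}
    (hQ : Q ∈ D) : ∃ g ∈ densities P D, g =ᵐ[P] fun ω => (Q.rnDeriv P ω).toReal := by
  have := (hD hQ).1
  have hi : Integrable (fun ω => (Q.rnDeriv P ω).toReal) P := Measure.integrable_toReal_rnDeriv
  exact ⟨hi.toL1 _, ⟨Q, hQ, hi.coeFn_toL1⟩, hi.coeFn_toL1⟩

theorem continuous_integral_mul_of_bounded [IsProbabilityMeasure P]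
    {f : Ω → ℝ} (hf : AEStronglyMeasurable f P) {C : ℝ}
    (hC : ∀ ω, ‖f ω‖ ≤ C) :
    Continuous fun w : WeakSpace ℝ (Lp ℝ 1 P) =>
      ∫ ω, (toWeakSpace ℝ (Lp ℝ 1 P)).symm w ω * f ω ∂P := by
  have hint : ∀ g : Lp ℝ 1 P, Integrable (fun ω => g ω * f ω) P := fun g =>
    (L1.integrable_coeFn g).mul_bdd hf (ae_of_all _ hC)
  let L : Lp ℝ 1 P →ₗ[ℝ] ℝ :=
    { toFun := fun g => ∫ ω, g ω * f ω ∂P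
      map_add' := fun g g' => by
        rw [← integral_add (hint g) (hint g')]
        refine integral_congr_ae ((Lp.coeFn_add g g').mono fun ω hω => ?_)
        simp only [hω, Pi.add_apply, add_mul]
      map_smul' := fun r g => by
        rw [RingHom.id_apply, ← integral_smul]
        refine integral_congr_ae ((Lp.coeFn_smul r g).mono fun ω hω => ?_)
        simp only [hω, Pi.smul_apply, smul_eq_mul, mul_assoc] }
  let L' : Lp ℝ 1 P →L[ℝ] ℝ := L.mkContinuous C fun g => by
    rw [L1.norm_eq_integral_norm, ← integral_const_mul]
    refine (norm_integral_le_integral_norm _).trans (integral_mono (hint g).norm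
      ((L1.integrable_coeFn g).norm.const_mul C) fun ω => ?_)
    simp only [norm_mul]
    rw [mul_comm]
    exact mul_le_mul_of_nonneg_right (hC ω) (norm_nonneg _)
  exact WeakBilin.eval_continuous _ L'

/-- Truncations of `X` give weakly continuous functionals, and the defining tail condition makes
them converge uniformly over `D`. -/
theorem isRegular_of_mem_strongL1 [IsProbabilityMeasure P]
    {D : Set (Measure Ω)} (hD : D ⊆ acProb P) {X : Ω →ₘ[P] ℝ}
    (hX : X ∈ strongL1 P D) : IsRegular P D X := by
  have hms : ∀ k : ℕ, MeasurableSet {ω | (k : ℝ) < |X ω|} := fun k =>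
    measurableSet_lt measurable_const X.stronglyMeasurable.measurable.abs
  have hX' := hX
  rw [strongL1, Set.mem_ofPred_eq, ENNReal.tendsto_nhds_zero] at hX'
  have hint : ∀ Q ∈ D, Integrable X Q := fun Q hQ => by
    have := (hD hQ).1
    obtain ⟨k, hk⟩ := (hX' 1 one_pos).exists
    rw [← integrableOn_univ, ← Set.union_compl_self {ω | (k : ℝ) < |X ω|}]
    refine IntegrableOn.union ⟨X.stronglyMeasurable.aestronglyMeasurable, ?_⟩ ?_
    · rw [hasFiniteIntegral_iff_norm]
      exact ((le_iSup₂ (f := fun Q (_ : Q ∈ D) => ∫⁻ ω in {ω | (k : ℝ) < |X ω|},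
        ENNReal.ofReal |X ω| ∂Q) Q hQ).trans hk).trans_lt ENNReal.one_lt_top
    · refine Measure.integrableOn_of_bounded (M := k) (measure_ne_top _ _)
        X.stronglyMeasurable.aestronglyMeasurable ?_
      refine (ae_restrict_iff' (hms k).compl).2 (ae_of_all _ fun ω hω => ?_)
      simpa using hω
  refine ⟨hint, ?_⟩
  let T : ℕ → Ω → ℝ := fun k => {ω | (k : ℝ) < |X ω|}ᶜ.indicator X
  have hTm : ∀ k, StronglyMeasurable (T k) := fun k => X.stronglyMeasurable.indicator (hms k).compl
  have hTb : ∀ k ω, ‖T k ω‖ ≤ k := fun k ω => by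
    by_cases hω : ω ∈ {ω | (k : ℝ) < |X ω|}ᶜ
    · simpa [T, Set.indicator_of_mem hω] using hω
    · simp [T, Set.indicator_of_notMem hω]
  have hunif : TendstoUniformlyOn
      (fun (k : ℕ) (w : WeakSpace ℝ (Lp ℝ 1 P)) =>
        ∫ ω, (toWeakSpace ℝ (Lp ℝ 1 P)).symm w ω * T k ω ∂P)
      (fun w => ∫ ω, (toWeakSpace ℝ (Lp ℝ 1 P)).symm w ω * X ω ∂P) atTop
      (toWeakSpace ℝ (Lp ℝ 1 P) '' densities P D) := by
    rw [Metric.tendstoUniformlyOn_iff]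
    intro ε hε
    filter_upwards [hX' (ENNReal.ofReal (ε / 2)) (by simpa using hε)] with k hk
    rintro _ ⟨g, ⟨Q, hQ, hg⟩, rfl⟩
    have := (hD hQ).1
    simp only [LinearEquiv.symm_apply_apply]
    have hTi : Integrable (T k) Q := (hint Q hQ).indicator (hms k).compl
    rw [integral_density_mul (hD hQ) hg, integral_density_mul (hD hQ) hg, dist_eq_norm,
      ← integral_sub (hint Q hQ) hTi]
    have heq : ∀ ω, X ω - T k ω = {ω | (k : ℝ) < |X ω|}.indicator X ω := fun ω => by
      simp only [T, Set.indicator_compl, Pi.sub_apply, sub_sub_cancel]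
    simp_rw [heq]
    rw [integral_indicator (hms k)]
    have hle : ENNReal.ofReal ‖∫ ω in {ω | (k : ℝ) < |X ω|}, X ω ∂Q‖ ≤ ENNReal.ofReal (ε / 2) := by
      refine le_trans ?_ ((le_iSup₂ (f := fun Q (_ : Q ∈ D) => ∫⁻ ω in {ω | (k : ℝ) < |X ω|},
        ENNReal.ofReal |X ω| ∂Q) Q hQ).trans hk)
      exact (ENNReal.ofReal_le_ofReal (norm_integral_le_lintegral_norm _)).trans
        ENNReal.ofReal_toReal_le
    have := (ENNReal.ofReal_le_ofReal_iff (by positivity)).1 hle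
    linarith
  exact hunif.continuousOn (Frequently.of_forall fun k =>
    (continuous_integral_mul_of_bounded (hTm k).aestronglyMeasurable (hTb k)).continuousOn)

variable {D : Set (Measure Ω)} {X Y : Ω →ₘ[P] ℝ}

theorem integrable_coe_add {Q : Measure Ω} (hQ : Q ≪ P) (hX : Integrable X Q)
    (hY : Integrable Y Q) : Integrable (X + Y : Ω →ₘ[P] ℝ) Q :=
  (hX.add hY).congr (hQ.ae_eq (AEEqFun.coeFn_add X Y)).symm

theorem integral_coe_add {Q : Measure Ω} (hQ : Q ≪ P) (hX : Integrable X Q)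
    (hY : Integrable Y Q) : ∫ ω, (X + Y : Ω →ₘ[P] ℝ) ω ∂Q = ∫ ω, X ω ∂Q + ∫ ω, Y ω ∂Q := by
  rw [← integral_add hX hY]
  exact integral_congr_ae (hQ.ae_eq (AEEqFun.coeFn_add X Y))

theorem integrable_coe_smul {Q : Measure Ω} (hQ : Q ≪ P) (r : ℝ) (hX : Integrable X Q) :
    Integrable (r • X : Ω →ₘ[P] ℝ) Q :=
  (hX.smul r).congr (hQ.ae_eq (AEEqFun.coeFn_smul r X)).symm

theorem integral_coe_smul {Q : Measure Ω} (hQ : Q ≪ P) (r : ℝ) :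
    ∫ ω, (r • X : Ω →ₘ[P] ℝ) ω ∂Q = r * ∫ ω, X ω ∂Q := by
  rw [← smul_eq_mul, ← integral_smul]
  exact integral_congr_ae (hQ.ae_eq (AEEqFun.coeFn_smul r X))

theorem integrable_coe_zero {Q : Measure Ω} (hQ : Q ≪ P) :
    Integrable (0 : Ω →ₘ[P] ℝ) Q :=
  (integrable_zero Ω ℝ Q).congr (hQ.ae_eq AEEqFun.coeFn_zero).symm

theorem integral_coe_zero {Q : Measure Ω} (hQ : Q ≪ P) :
    ∫ ω, (0 : Ω →ₘ[P] ℝ) ω ∂Q = 0 := by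
  rw [integral_congr_ae (hQ.ae_eq AEEqFun.coeFn_zero)]
  simp

theorem IsRegular.zero [IsProbabilityMeasure P] (hD : D ⊆ acProb P) : IsRegular P D 0 where
  integrable Q hQ := integrable_coe_zero (hD hQ).2
  continuousOn := by
    refine (continuousOn_const (c := (0 : ℝ))).congr ?_
    rintro _ ⟨g, ⟨Q, hQ, hg⟩, rfl⟩
    simp only [LinearEquiv.symm_apply_apply]
    rw [integral_density_mul (hD hQ) hg, integral_coe_zero (hD hQ).2]

theorem IsRegular.add [IsProbabilityMeasure P]
    (hD : D ⊆ acProb P) (hX : IsRegular P D X) (hY : IsRegular P D Y) :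
    IsRegular P D (X + Y) where
  integrable Q hQ := integrable_coe_add (hD hQ).2 (hX.integrable Q hQ) (hY.integrable Q hQ)
  continuousOn := by
    refine (hX.continuousOn.add hY.continuousOn).congr ?_
    rintro _ ⟨g, ⟨Q, hQ, hg⟩, rfl⟩
    simp only [LinearEquiv.symm_apply_apply, Pi.add_apply]
    rw [integral_density_mul (hD hQ) hg, integral_density_mul (hD hQ) hg,
      integral_density_mul (hD hQ) hg,
      integral_coe_add (hD hQ).2 (hX.integrable Q hQ) (hY.integrable Q hQ)]

theorem IsRegular.smul [IsProbabilityMeasure P]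
    (hD : D ⊆ acProb P) (r : ℝ) (hX : IsRegular P D X) :
    IsRegular P D (r • X) where
  integrable Q hQ := integrable_coe_smul (hD hQ).2 r (hX.integrable Q hQ)
  continuousOn := by
    refine (hX.continuousOn.const_smul r).congr ?_
    rintro _ ⟨g, ⟨Q, hQ, hg⟩, rfl⟩
    simp only [LinearEquiv.symm_apply_apply, Pi.smul_apply]
    rw [integral_density_mul (hD hQ) hg, integral_density_mul (hD hQ) hg,
      integral_coe_smul (hD hQ).2, smul_eq_mul]

theorem IsRegular.sum [IsProbabilityMeasure P]
    (hD : D ⊆ acProb P) {ι : Type*} (s : Finset ι) {Z : ι → (Ω →ₘ[P] ℝ)}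
    (hZ : ∀ i ∈ s, IsRegular P D (Z i)) : IsRegular P D (∑ i ∈ s, Z i) :=
  Finset.sum_induction _ _ (fun _ _ => IsRegular.add hD) (IsRegular.zero hD) hZ

theorem integrable_coe_sum_smul {Q : Measure Ω} (hQ : Q ≪ P) {ι : Type*} (s : Finset ι)
    (h : ι → ℝ) {Z : ι → (Ω →ₘ[P] ℝ)} (hZ : ∀ i ∈ s, Integrable (Z i) Q) :
    Integrable (∑ i ∈ s, h i • Z i : Ω →ₘ[P] ℝ) Q :=
  Finset.sum_induction (fun i => h i • Z i) (fun Y : Ω →ₘ[P] ℝ => Integrable Y Q)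
    (fun _ _ => integrable_coe_add hQ) (integrable_coe_zero hQ)
    fun i hi => integrable_coe_smul hQ _ (hZ i hi)

theorem integral_coe_sum_smul {Q : Measure Ω} (hQ : Q ≪ P) {ι : Type*} (s : Finset ι)
    (h : ι → ℝ) {Z : ι → (Ω →ₘ[P] ℝ)} (hZ : ∀ i ∈ s, Integrable (Z i) Q) :
    ∫ ω, (∑ i ∈ s, h i • Z i : Ω →ₘ[P] ℝ) ω ∂Q = ∑ i ∈ s, h i * ∫ ω, Z i ω ∂Q := by
  classical
  induction s using Finset.induction_on with
  | empty => simpa using integral_coe_zero hQ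
  | insert j s hj ih =>
    have hs : ∀ i ∈ s, Integrable (Z i) Q := fun i hi => hZ i (Finset.mem_insert_of_mem hi)
    rw [Finset.sum_insert hj, Finset.sum_insert hj, integral_coe_add hQ
      (integrable_coe_smul hQ _ (hZ j (Finset.mem_insert_self j s)))
      (integrable_coe_sum_smul hQ s h hs), integral_coe_smul hQ, ih hs]

end CoherentRisk

/-! ### Upper bound by common prices -/

namespace CoherentRisk

variable {Ω : Type*} [MeasurableSpace Ω] {P : Measure Ω}

theorem coe_finset_sum {ι : Type*} (s : Finset ι) (f : ι → ℝ) :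
    ((∑ i ∈ s, f i : ℝ) : EReal) = ∑ i ∈ s, (f i : EReal) := by
  classical
  induction s using Finset.induction_on with
  | empty => simp
  | insert j s hj ih => rw [Finset.sum_insert hj, Finset.sum_insert hj, EReal.coe_add, ih]

theorem integral_position {d : ℕ} {Q : Measure Ω} (hQ : Q ≪ P) {W X : Ω →ₘ[P] ℝ}
    {S : Fin d → (Ω →ₘ[P] ℝ)} (hW : Integrable W Q) (hX : Integrable X Q)
    (hS : ∀ i, Integrable (S i) Q) (h : Fin d → ℝ) :
    ∫ ω, (W + X + ∑ i, h i • S i : Ω →ₘ[P] ℝ) ω ∂Q =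
      ∫ ω, W ω ∂Q + ∫ ω, X ω ∂Q + ∑ i, h i * ∫ ω, S i ω ∂Q := by
  rw [integral_coe_add hQ (integrable_coe_add hQ hW hX)
    (integrable_coe_sum_smul hQ _ h fun i _ => hS i), integral_coe_add hQ hW hX,
    integral_coe_sum_smul hQ _ h fun i _ => hS i]

theorem iInf_expect_le_of_mem_jointGenerator {d : ℕ} {D : Set (Measure Ω)}
    {A : Set (Ω →ₘ[P] ℝ)} {W X : Ω →ₘ[P] ℝ} {S : Fin d → (Ω →ₘ[P] ℝ)}
    (hW : ∀ Q ∈ D, Integrable W Q) (hS : ∀ i, ∀ Q ∈ D, Integrable (S i) Q) (hX : X ∈ A)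
    (h : Fin d → ℝ) {p : (Fin d → ℝ) × ℝ} (hp : p ∈ jointGenerator (D ∩ riskNeutral A) S W) :
    ⨅ Q ∈ D, expect Q (W + X + ∑ i, h i • S i) ≤ ((p.2 + ∑ i, h i * p.1 i : ℝ) : EReal) := by
  -- The inequality is closed in `p`, so only points coming from an actual measure need checking.
  refine closure_minimal (t := {p : (Fin d → ℝ) × ℝ |
    ⨅ Q ∈ D, expect Q (W + X + ∑ i, h i • S i) ≤ ((p.2 + ∑ i, h i * p.1 i : ℝ) : EReal)}) ?_
    (isClosed_le continuous_const (continuous_coe_real_ereal.comp (by fun_prop))) hp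
  rintro _ ⟨Q, ⟨hQD, ⟨-, hQ⟩, hQA⟩, rfl⟩
  refine (iInf₂_le (f := fun Q (_ : Q ∈ D) => expect Q (W + X + ∑ i, h i • S i)) Q hQD).trans ?_
  have hSi := integrable_coe_sum_smul hQ Finset.univ h fun i _ => hS i Q hQD
  have := expect_add_le hQ (integrable_coe_add hQ (hW Q hQD) hSi) (hQA X hX)
  rwa [add_right_comm, integral_coe_add hQ (hW Q hQD) hSi,
    integral_coe_sum_smul hQ _ h fun i _ => hS i Q hQD] at this

theorem iInf_expect_le_lowerBoundary_add {d : ℕ} {D : Set (Measure Ω)}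
    {A : Set (Ω →ₘ[P] ℝ)} {W X : Ω →ₘ[P] ℝ} {S : Fin d → (Ω →ₘ[P] ℝ)}
    (hW : ∀ Q ∈ D, Integrable W Q) (hS : ∀ i, ∀ Q ∈ D, Integrable (S i) Q) (hX : X ∈ A)
    (h x : Fin d → ℝ) :
    ⨅ Q ∈ D, expect Q (W + X + ∑ i, h i • S i) ≤
      lowerBoundary (jointGenerator (D ∩ riskNeutral A) S W) x
        + ((∑ i, h i * x i : ℝ) : EReal) := by
  rw [← EReal.sub_le_iff_le_add (.inl (EReal.coe_ne_bot _)) (.inl (EReal.coe_ne_top _))]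
  refine le_iInf₂ fun y hy => ?_
  rw [EReal.sub_le_iff_le_add (.inl (EReal.coe_ne_bot _)) (.inl (EReal.coe_ne_top _)),
    ← EReal.coe_add]
  exact iInf_expect_le_of_mem_jointGenerator hW hS hX h hy

theorem maxOverallUtility_le {N d : ℕ} {u : Fin N → (Ω →ₘ[P] ℝ) → EReal}
    {D : Fin N → Set (Measure Ω)} (hu : ∀ n X, u n X = ⨅ Q ∈ D n, expect Q X)
    {A : Fin N → Set (Ω →ₘ[P] ℝ)} {W : Fin N → (Ω →ₘ[P] ℝ)} {S : Fin d → (Ω →ₘ[P] ℝ)}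
    (hW : ∀ n, ∀ Q ∈ D n, Integrable (W n) Q) (hS : ∀ n i, ∀ Q ∈ D n, Integrable (S i) Q)
    (x : Fin d → ℝ) :
    maxOverallUtility u A W S ≤
      ∑ n, lowerBoundary (jointGenerator (D n ∩ riskNeutral (A n)) S (W n)) x := by
  refine iSup₂_le fun X hX => iSup₂_le fun h hh => ?_
  have hzero : ∑ n, ∑ i, h n i * x i = 0 := by
    rw [Finset.sum_comm]
    refine Finset.sum_eq_zero fun i _ => ?_
    rw [← Finset.sum_mul, ← Finset.sum_apply, hh, Pi.zero_apply, zero_mul]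
  calc ∑ n, u n (W n + X n + ∑ i, h n i • S i)
      ≤ ∑ n, (lowerBoundary (jointGenerator (D n ∩ riskNeutral (A n)) S (W n)) x
          + ((∑ i, h n i * x i : ℝ) : EReal)) := Finset.sum_le_sum fun n _ => by
        rw [hu]
        exact iInf_expect_le_lowerBoundary_add (hW n) (hS n) (hX n) (h n) x
    _ = ∑ n, lowerBoundary (jointGenerator (D n ∩ riskNeutral (A n)) S (W n)) x := by
        rw [Finset.sum_add_distrib, ← coe_finset_sum, hzero, EReal.coe_zero, add_zero]

/-! ### Lower bound for a fixed tuple of measures -/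

/-- For each fixed choice of measures, some admissible trade beats every level below the infimum of
the aggregate lower boundary. -/
theorem exists_trade_lt {N d : ℕ} {D : Fin N → Set (Measure Ω)} (hDac : ∀ n, D n ⊆ acProb P)
    {A : Fin N → PointedCone ℝ (Ω →ₘ[P] ℝ)}
    (hA : ∀ n, IsConsistent (D n) (A n : Set (Ω →ₘ[P] ℝ)))
    {W : Fin N → (Ω →ₘ[P] ℝ)} {S : Fin d → (Ω →ₘ[P] ℝ)}
    (hInt : ∀ n, ∀ X ∈ strongL1 P (D n), ∀ Q ∈ D n, Integrable X Q)
    {r : ℝ} (hr : (r : EReal) <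
      ⨅ x ∈ ⋂ n, generator (D n ∩ riskNeutral (A n : Set (Ω →ₘ[P] ℝ))) S,
        ∑ n, lowerBoundary
          (jointGenerator (D n ∩ riskNeutral (A n : Set (Ω →ₘ[P] ℝ))) S (W n)) x)
    {Q : Fin N → Measure Ω} (hQ : ∀ n, Q n ∈ D n) :
    ∃ (X : Fin N → (Ω →ₘ[P] ℝ)) (h : Fin N → Fin d → ℝ),
      (∀ n, ∃ t : ℝ, 0 ≤ t ∧ ∃ X' ∈ (A n : Set (Ω →ₘ[P] ℝ)) ∩ strongL1 P (D n) ∪ {0},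
        X n = t • X') ∧ ∑ n, h n = 0 ∧
      r < ∑ n, (∫ ω, W n ω ∂Q n + ∫ ω, X n ω ∂Q n + ∑ i, h n i * ∫ ω, S i ω ∂Q n) := by
  classical
  have hac : ∀ n, Q n ≪ P := fun n => (hDac n (hQ n)).2
  set w := ∑ n, ∫ ω, W n ω ∂Q n with hw
  by_cases hRN : ∀ n, Q n ∈ riskNeutral (A n : Set (Ω →ₘ[P] ℝ))
  swap
  · push Not at hRN
    obtain ⟨m, hm⟩ := hRN
    obtain ⟨A', hA', hAA'⟩ := hA m
    have hm' : Q m ∉ riskNeutral A' := fun h =>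
      hm (hAA'.symm.subset ⟨hQ m, h⟩).2
    obtain ⟨X, hX, hpos⟩ : ∃ X ∈ A', 0 < expect (Q m) X := by
      by_contra! hcon
      exact hm' ⟨hDac m (hQ m), hcon⟩
    have hXi := hInt m X (hA' hX).2 _ (hQ m)
    rw [expect_eq_integral hXi] at hpos
    have hp : 0 < ∫ ω, X ω ∂Q m := by exact_mod_cast hpos
    set p := ∫ ω, X ω ∂Q m
    -- The scaling makes the gain exactly `|r - w| + 1`, which exceeds `r - w`.
    refine ⟨Pi.single m (((|r - w| + 1) / p) • X), 0, fun n => ?_, by simp, ?_⟩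
    · rcases eq_or_ne n m with rfl | hn
      · exact ⟨(|r - w| + 1) / p, by positivity, X, .inl (hA' hX), by simp⟩
      · exact ⟨0, le_rfl, 0, .inr rfl, by simp [hn]⟩
    · rw [Finset.sum_add_distrib, Finset.sum_add_distrib, ← hw, Finset.sum_eq_single m]
      · rw [Pi.single_eq_same, integral_coe_smul (hac m), div_mul_cancel₀ _ hp.ne']
        simp only [Pi.zero_apply, zero_mul, Finset.sum_const_zero, add_zero]
        linarith [le_abs_self (r - w)]
      · intro n _ hn
        rw [Pi.single_eq_of_ne hn, integral_coe_zero (hac n)]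
      · simp
  have hmem : ∀ n, ∃ t : ℝ, 0 ≤ t ∧ ∃ X' ∈ (A n : Set (Ω →ₘ[P] ℝ)) ∩ strongL1 P (D n) ∪ {0},
      (0 : Fin N → (Ω →ₘ[P] ℝ)) n = t • X' := fun n => ⟨0, le_rfl, 0, .inr rfl, by simp⟩
  have hX0 : ∀ h : Fin N → Fin d → ℝ,
      ∑ n, (∫ ω, W n ω ∂Q n + ∫ ω, (0 : Fin N → (Ω →ₘ[P] ℝ)) n ω ∂Q n
        + ∑ i, h n i * ∫ ω, S i ω ∂Q n) = w + ∑ n, ∑ i, h n i * ∫ ω, S i ω ∂Q n := fun h => by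
    rw [← Finset.sum_add_distrib]
    refine Finset.sum_congr rfl fun n _ => ?_
    rw [Pi.zero_apply, integral_coe_zero (hac n), add_zero]
  by_cases hx : ∃ x : Fin d → ℝ, ∀ n, (fun i => ∫ ω, S i ω ∂Q n) = x
  · obtain ⟨x, hx⟩ := hx
    refine ⟨0, 0, hmem, by simp, ?_⟩
    rw [hX0]
    simp only [Pi.zero_apply, zero_mul, Finset.sum_const_zero, add_zero]
    have hxG : x ∈ ⋂ n, generator (D n ∩ riskNeutral (A n : Set (Ω →ₘ[P] ℝ))) S :=
      Set.mem_iInter.2 fun n => subset_closure ⟨Q n, ⟨hQ n, hRN n⟩, hx n⟩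
    have hmemG : ∀ n, (x, ∫ ω, W n ω ∂Q n) ∈
        jointGenerator (D n ∩ riskNeutral (A n : Set (Ω →ₘ[P] ℝ))) S (W n) := fun n =>
      subset_closure ⟨Q n, ⟨hQ n, hRN n⟩, Prod.ext (hx n) rfl⟩
    have hle := hr.trans_le ((iInf₂_le x hxG).trans (Finset.sum_le_sum fun n _ =>
      iInf₂_le (∫ ω, W n ω ∂Q n) (hmemG n)))
    rw [← coe_finset_sum] at hle
    exact_mod_cast hle
  · push Not at hx
    -- Any test vector yields some agent `m`; the prices of `m` then yield an agent `k` who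
    -- disagrees, and `t` units of asset `i` pass from `m` to `k`.
    obtain ⟨m, -⟩ := hx 0
    obtain ⟨k, hk⟩ := hx fun i => ∫ ω, S i ω ∂Q m
    obtain ⟨i, hi⟩ := Function.ne_iff.1 hk
    have hkm : k ≠ m := by
      rintro rfl
      exact hi rfl
    set p := ∫ ω, S i ω ∂Q k - ∫ ω, S i ω ∂Q m with hp
    have hp0 : p ≠ 0 := sub_ne_zero.2 hi
    let t : ℝ := (|r - w| + 1) / p
    refine ⟨0, Pi.single k (Pi.single i t) - Pi.single m (Pi.single i t), hmem, ?_, ?_⟩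
    · simp [Finset.sum_sub_distrib]
    · rw [hX0]
      have h1 : ∀ l : Fin N, ∑ n, ∑ j, (Pi.single l (Pi.single i t) : Fin N → Fin d → ℝ) n j
          * ∫ ω, S j ω ∂Q n = t * ∫ ω, S i ω ∂Q l := fun l => by
        rw [Finset.sum_eq_single l, Finset.sum_eq_single i]
        · simp
        · intro j _ hj
          simp [hj]
        · simp
        · intro n _ hn
          simp [hn]
        · simp
      simp only [Pi.sub_apply, sub_mul, Finset.sum_sub_distrib, h1]
      rw [← mul_sub, ← hp, div_mul_cancel₀ _ hp0]
      linarith [le_abs_self (r - w)]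

end CoherentRisk

/-! ### The main theorem -/

open CoherentRisk in
theorem mainTheorem5 {Ω : Type*} [MeasurableSpace Ω] (P : Measure Ω) [IsProbabilityMeasure P]
    (N d : ℕ)
    (u : Fin N → (Ω →ₘ[P] ℝ) → EReal) (D : Fin N → Set (Measure Ω))
    (hD : ∀ n, IsDeterminingSet P (u n) (D n)) (hDc : ∀ n, IsWeaklyCompact P (D n))
    (A : Fin N → PointedCone ℝ (Ω →ₘ[P] ℝ)) (hA : ∀ n, IsConsistent (D n) (A n : Set (Ω →ₘ[P] ℝ)))
    (W : Fin N → (Ω →ₘ[P] ℝ)) (hW : ∀ n, W n ∈ strongL1 P (D n))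
    (S : Fin d → (Ω →ₘ[P] ℝ)) (hS : ∀ i, ∀ n, S i ∈ strongL1 P (D n)) :
    maxOverallUtility u (fun n => (A n : Set (Ω →ₘ[P] ℝ))) W S =
      ⨅ x ∈ ⋂ n, generator (D n ∩ riskNeutral (A n : Set (Ω →ₘ[P] ℝ))) S,
        ∑ n, lowerBoundary
          (jointGenerator (D n ∩ riskNeutral (A n : Set (Ω →ₘ[P] ℝ))) S (W n)) x := by
  have hDac : ∀ n, D n ⊆ acProb P := fun n => (hD n).1.2.1
  have hu : ∀ n X, u n X = ⨅ Q ∈ D n, expect Q X := fun n => (hD n).1.2.2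
  have hreg : ∀ n, ∀ X ∈ strongL1 P (D n), IsRegular P (D n) X := fun n X hX =>
    isRegular_of_mem_strongL1 (hDac n) hX
  refine le_antisymm (le_iInf₂ fun x _ => maxOverallUtility_le hu
    (fun n => (hreg n _ (hW n)).integrable) (fun n i => (hreg n _ (hS i n)).integrable) x) ?_
  refine le_of_forall_lt fun c hc => ?_
  obtain ⟨r, hcr, hr⟩ := EReal.lt_iff_exists_real_btwn.1 hc
  refine hcr.trans_le ?_
  let Y : (Fin N → (Ω →ₘ[P] ℝ)) × (Fin N → Fin d → ℝ) → Fin N → (Ω →ₘ[P] ℝ) :=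
    fun e n => W n + e.1 n + ∑ i, e.2 n i • S i
  let K : Fin N → Set (WeakSpace ℝ (Lp ℝ 1 P)) :=
    fun n => toWeakSpace ℝ (Lp ℝ 1 P) '' densities P (D n)
  let I : WeakSpace ℝ (Lp ℝ 1 P) → (Ω →ₘ[P] ℝ) → ℝ :=
    fun w X => ∫ ω, (toWeakSpace ℝ (Lp ℝ 1 P)).symm w ω * X ω ∂P
  -- Restricting to regular claims makes the payoff real, affine and continuous; the trades from
  -- `exists_trade_lt` all lie here.
  let C : Set ((Fin N → (Ω →ₘ[P] ℝ)) × (Fin N → Fin d → ℝ)) :=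
    {e | (∀ n, e.1 n ∈ A n ∧ IsRegular P (D n) (e.1 n)) ∧ ∑ n, e.2 n = 0}
  have hKQ : ∀ n, ∀ w ∈ K n, ∃ Q ∈ D n, ∀ X, I w X = ∫ ω, X ω ∂Q := by
    rintro n _ ⟨g, ⟨Q, hQ, hg⟩, rfl⟩
    refine ⟨Q, hQ, fun X => ?_⟩
    simp only [I, LinearEquiv.symm_apply_apply]
    exact integral_density_mul (hDac n hQ) hg _
  have hQK : ∀ n, ∀ Q ∈ D n, ∃ w ∈ K n, ∀ X, I w X = ∫ ω, X ω ∂Q := fun n Q hQ => by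
    obtain ⟨g, hgD, hg⟩ := exists_mem_densities (hDac n) hQ
    refine ⟨_, ⟨g, hgD, rfl⟩, fun X => ?_⟩
    simp only [I, LinearEquiv.symm_apply_apply]
    exact integral_density_mul (hDac n hQ) hg _
  have hKne : ∀ n, (K n).Nonempty := fun n => by
    obtain ⟨Q, hQ⟩ := (hD n).1.1
    obtain ⟨w, hw, -⟩ := hQK n Q hQ
    exact ⟨w, hw⟩
  have hYreg : ∀ e ∈ C, ∀ n, IsRegular P (D n) (Y e n) := fun e he n =>
    ((hreg n _ (hW n)).add (hDac n) (he.1 n).2).add (hDac n)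
      (IsRegular.sum (hDac n) _ fun i _ => (hreg n _ (hS i n)).smul (hDac n) _)
  have hYint : ∀ e ∈ C, ∀ n, ∀ Q ∈ D n, ∫ ω, Y e n ω ∂Q =
      ∫ ω, W n ω ∂Q + ∫ ω, e.1 n ω ∂Q + ∑ i, e.2 n i * ∫ ω, S i ω ∂Q := fun e he n Q hQ =>
    integral_position (hDac n hQ).2 ((hreg n _ (hW n)).integrable Q hQ)
      ((he.1 n).2.integrable Q hQ) (fun i => (hreg n _ (hS i n)).integrable Q hQ) _
  have hC : Convex ℝ C := by
    rintro e he e' he' a b ha hb -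
    refine ⟨fun n => ⟨?_, ?_⟩, ?_⟩
    · exact (A n).add_mem ((A n).smul_mem ha (he.1 n).1)
        ((A n).smul_mem hb (he'.1 n).1)
    · exact ((he.1 n).2.smul (hDac n) a).add (hDac n) ((he'.1 n).2.smul (hDac n) b)
    · simp only [Prod.snd_add, Prod.smul_snd, Pi.add_apply, Pi.smul_apply]
      rw [Finset.sum_add_distrib, ← Finset.smul_sum, ← Finset.smul_sum, he.2, he'.2]
      simp
  obtain ⟨e, he, hlt⟩ := exists_forall_lt_of_forall_exists_lt hC
    (isCompact_univ_pi hDc) (Set.univ_pi_nonempty_iff.2 hKne)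
    (fun e w => ∑ n, I (w n) (Y e n)) r
    (fun e he => continuousOn_finsetSum _ fun n _ =>
      (hYreg e he n).continuousOn.comp (continuous_apply n).continuousOn fun w hw => hw n trivial)
    (fun w hw => by
      choose Q hQ hI using fun n => hKQ n (w n) (hw n trivial)
      refine ⟨hC, fun e he e' he' a b ha hb hab => le_of_eq ?_⟩
      simp only [hI, smul_eq_mul, Finset.mul_sum]
      rw [← Finset.sum_add_distrib]
      refine Finset.sum_congr rfl fun n _ => ?_
      have hac := (hDac n (hQ n)).2
      have i1 := (he.1 n).2.integrable _ (hQ n)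
      have i2 := (he'.1 n).2.integrable _ (hQ n)
      rw [hYint e he n _ (hQ n), hYint e' he' n _ (hQ n),
        hYint _ (hC he he' ha hb hab) n _ (hQ n)]
      simp only [Prod.fst_add, Prod.smul_fst, Prod.snd_add, Prod.smul_snd, Pi.add_apply,
        Pi.smul_apply, smul_eq_mul]
      rw [integral_coe_add hac (integrable_coe_smul hac a i1) (integrable_coe_smul hac b i2),
        integral_coe_smul hac, integral_coe_smul hac]
      simp only [add_mul, Finset.sum_add_distrib, mul_assoc, ← Finset.mul_sum]
      linear_combination (∫ ω, W n ω ∂Q n) * hab)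
    (fun w hw w' hw' a b ha hb hab => by
      choose Q hQ hI using fun n => hKQ n (w n) (hw n trivial)
      choose Q' hQ' hI' using fun n => hKQ n (w' n) (hw' n trivial)
      choose z hz hzI using fun n => hQK n _ ((hD n).mix_mem ha hb hab (hQ n) (hQ' n))
      refine ⟨z, fun n _ => hz n, fun e he => ?_⟩
      simp only [hI, hI', hzI, Finset.mul_sum]
      rw [← Finset.sum_add_distrib]
      exact Finset.sum_congr rfl fun n _ => integral_mix ha hb
        ((hYreg e he n).integrable _ (hQ n)) ((hYreg e he n).integrable _ (hQ' n)))
    (fun w hw => by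
      choose Q hQ hI using fun n => hKQ n (w n) (hw n trivial)
      obtain ⟨X, h, hX, hh, hlt⟩ := exists_trade_lt hDac hA
        (fun n X hX => (hreg n X hX).integrable) hr hQ
      have heC : (X, h) ∈ C := by
        refine ⟨fun n => ?_, hh⟩
        obtain ⟨t, ht, X', hX', hXn⟩ := hX n
        simp only [hXn]
        rcases hX' with hX' | rfl
        · exact ⟨(A n).smul_mem ht hX'.1, (hreg n _ hX'.2).smul (hDac n) t⟩
        · rw [smul_zero]
          exact ⟨(A n).zero_mem, .zero (hDac n)⟩
      refine ⟨(X, h), heC, hlt.trans_eq (Finset.sum_congr rfl fun n _ => ?_)⟩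
      rw [hI, hYint _ heC n _ (hQ n)])
  -- The uniform bound covers all tuples, so each agent's worst case can be inserted independently,
  -- turning the sum of minima into a lower bound for the sum of utilities.
  choose w hw hmin using fun n =>
    (hDc n).exists_isMinOn (hKne n) (hYreg e he n).continuousOn
  have hle : ∀ n, ((I (w n) (Y e n) : ℝ) : EReal) ≤ u n (Y e n) := fun n => by
    rw [hu]
    refine le_iInf₂ fun Q hQ => ?_
    obtain ⟨z, hz, hzI⟩ := hQK n Q hQ
    rw [expect_eq_integral ((hYreg e he n).integrable Q hQ), ← hzI]
    exact EReal.coe_le_coe_iff.2 (hmin n hz)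
  calc (r : EReal) ≤ ((∑ n, I (w n) (Y e n) : ℝ) : EReal) :=
        EReal.coe_le_coe_iff.2 (hlt w fun n _ => hw n).le
    _ ≤ ∑ n, u n (Y e n) := by
        rw [coe_finset_sum]
        exact Finset.sum_le_sum fun n _ => hle n
    _ ≤ _ := le_iSup₂_of_le e.1 (fun n => (he.1 n).1) 
        (le_iSup₂ (f := fun (h : Fin N → Fin d → ℝ) (_ : ∑ n, h n = 0) =>
          ∑ n, u n (W n + e.1 n + ∑ i, h n i • S i)) e.2 he.2)
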